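/- For $d\ge 0$ let $C_d^*$ be the graph on $2^{d+1}$ vertices obtained from the $d$-dimensional cube by attaching one pendant leaf to every vertex of the cube. A perfect secret sharing scheme realizing a graph $G=(V,E)$ with finite vertex set is a collection of jointly distributed discrete random variables $\xi_v$ $(v\in V)$ and $\xi_s$, with $0<H(\xi_s)<\infty$, such that for every $A\subseteq V$: if $A$ contains both endpoints of some edge, then $(\xi_v)_{v\in A}$ determines $\xi_s$ almost surely; otherwise $(\xi_v)_{v\in A}$ is independent of $\xi_s$. Here $H(\xi)=-\sum_j p_j\log p_j\in[0,\infty]$ is the Shannon entropy. The worst-case information ratio of $G$ is $$\sigma(G)=\inf_S\max_{v\in V}\frac{H(\xi_v)}{H(\xi_s)},$$ the infimum being taken over all perfect secret sharing schemes $S$ realizing $G$. Theorem. For every integer $\delta\ge 1$, the graph $C_{\delta-1}^*$ has $2^\delta$ vertices and maximum degree $\delta$, and $$\sigma(C_{\delta-1}^*)=\frac{\delta+1}{2}.$$ -/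

import Mathlib

open scoped ENNReal

namespace SecretSharing

/-- The cube graph of dimension `d`: the vertices are the `0`-`1` words of length `d`, and two words
are adjacent when they differ in exactly one coordinate. -/
def cube (d : ℕ) : SimpleGraph (Fin d → Bool) where
  Adj x y := hammingDist x y = 1
  symm := ⟨fun x y h => by rw [hammingDist_comm]; exact h⟩
  loopless := ⟨fun x h => by simp at h⟩

/-- The graph obtained from `G` by attaching one pendant leaf to every vertex. The vertices of `G`
are the `Sum.inl v`, and `Sum.inr v` is the leaf attached to `Sum.inl v`; the leaves are pairwise
non-adjacent. -/
def withLeaves {V : Type} (G : SimpleGraph V) : SimpleGraph (V ⊕ V) where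
  Adj
    | .inl u, .inl v => G.Adj u v
    | .inl u, .inr v => u = v
    | .inr u, .inl v => u = v
    | .inr _, .inr _ => False
  symm := ⟨by
    rintro (u | u) (v | v) h
    · exact SimpleGraph.Adj.symm h
    · exact Eq.symm h
    · exact Eq.symm h
    · exact h⟩
  loopless := ⟨by
    rintro (u | u) h
    · exact G.loopless.irrefl u h
    · exact h⟩

/-- The graph `C*_d`: the `d`-dimensional cube with a pendant leaf attached to every vertex. -/
abbrev cubeStar (d : ℕ) : SimpleGraph ((Fin d → Bool) ⊕ (Fin d → Bool)) :=
  withLeaves (cube d)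

/-- The Shannon entropy `-∑ p log p` (natural logarithm) of a discrete random variable `X` on a
discrete probability space `(Ω, p)`, computed from the law `p.map X` of `X`. All terms are
nonnegative, and the sum is taken in `[0, ∞]`. -/
noncomputable def entropy {Ω α : Type} (p : PMF Ω) (X : Ω → α) : ℝ≥0∞ :=
  ∑' x, ENNReal.ofReal (Real.negMulLog (p.map X x).toReal)

/-- On `(Ω, p)`, the value of `X` determines the value of `Y` almost surely. -/
def Determines {Ω α β : Type} (p : PMF Ω) (X : Ω → α) (Y : Ω → β) : Prop :=
  ∃ g : α → β, ∀ ω ∈ p.support, Y ω = g (X ω)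

/-- Independence of two discrete random variables: the joint law is the product of the laws. -/
def Indep {Ω α β : Type} (p : PMF Ω) (X : Ω → α) (Y : Ω → β) : Prop :=
  ∀ x y, p.map (fun ω => (X ω, Y ω)) (x, y) = p.map X x * p.map Y y

/-- A perfect secret sharing scheme on the participants `V`, realizing the access structure whose
qualified sets are the members of `𝒜`: discrete random variables `share v` (`v : V`) and `secret`
with a joint distribution, such that the shares of a qualified set determine the secret and the
shares of an unqualified set are independent of it. A `PMF` has countable support, so the random
variables take at most countably many values with positive probability. The secret has positive
finite entropy, so that information ratios make sense. -/
structure PerfectScheme {V : Type} (𝒜 : Set (Set V)) where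
  Ω : Type
  p : PMF Ω
  Share : V → Type
  Secret : Type
  share : ∀ v, Ω → Share v
  secret : Ω → Secret
  entropy_secret_ne_zero : entropy p secret ≠ 0
  entropy_secret_ne_top : entropy p secret ≠ ∞
  correct : ∀ A ∈ 𝒜, Determines p (fun ω (i : A) => share i ω) secret
  perfect : ∀ A ∉ 𝒜, Indep p (fun ω (i : A) => share i ω) secret

/-- The information ratio `H(ξ_v) / H(ξ_s)` of the participant `v`. -/
noncomputable def PerfectScheme.ratio {V : Type} {𝒜 : Set (Set V)} (S : PerfectScheme 𝒜) (v : V) :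
    ℝ≥0∞ :=
  entropy S.p (S.share v) / entropy S.p S.secret

/-- The access structure of a graph: the qualified sets are those that contain an edge. -/
def accessStructure {V : Type} (G : SimpleGraph V) : Set (Set V) :=
  {A | ∃ u ∈ A, ∃ v ∈ A, G.Adj u v}

/-- The worst-case information ratio `σ(G)`: the infimum, over all perfect secret sharing schemes
realizing `G`, of the largest information ratio of a participant. -/
noncomputable def worstCaseRatio {V : Type} (G : SimpleGraph V) : ℝ≥0∞ :=
  ⨅ S : PerfectScheme (accessStructure G), ⨆ v, S.ratio v

end SecretSharing

/-! Lower bound. The normalised joint entropy `f` of the shares is monotone and submodular, with an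
extra gain of 1 at the places where the secret becomes determined
(`PerfectScheme.isSecretPolymatroid`). For each cube vertex `v` consider the increment of `f` when
`v` joins `condSet k v`, and sum over all `v`. At `k = d` every increment is at least 1. Freezing
one more coordinate pairs the vertices along the edges of that direction, and each such edge raises
the sum by at least 1 (`increment_condSet_step`), so by at least `2 ^ d / 2` per coordinate. At `k =
0` the sum is at most the sum of the values `f {v}`, so these average at least `1 + d / 2` and some
cube vertex reaches that value.

Upper bound. The graph is bipartite. Share a two-bit secret, one bit per colour: the star at each
vertex `w` distributes the bit of the colour of `w`. An edge contains the centres of two stars of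
different colours, so it recovers both bits. A vertex stores one bit for itself and one per
neighbour, against two bits of secret, which gives the ratio `(Δ + 1) / 2 = (d + 2) / 2`
(`worstCaseRatio_le`). -/

namespace SecretSharing

/-! ### Entropy of discrete random variables -/

section Entropy

variable {Ω α β γ : Type}

theorem tsum_map_mul (p : PMF Ω) (X : Ω → α) (g : α → ℝ≥0∞) :
    ∑' x, p.map X x * g x = ∑' ω, p ω * g (X ω) := by
  simp_rw [PMF.map_apply, ← ENNReal.tsum_mul_right]
  rw [ENNReal.tsum_comm]
  refine tsum_congr fun ω => ?_
  rw [tsum_eq_single (X ω)]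
  · simp
  · intro x hx
    simp [hx]

theorem map_apply_self_ne_zero (p : PMF Ω) (X : Ω → α) {ω : Ω} (h : p ω ≠ 0) :
    p.map X (X ω) ≠ 0 := by
  rw [← PMF.mem_support_iff, PMF.mem_support_map_iff]
  exact ⟨ω, (PMF.mem_support_iff _ _).2 h, rfl⟩

/-- The information content `-log q` of an event of probability `q`. -/
noncomputable def info (q : ℝ≥0∞) : ℝ≥0∞ := ENNReal.ofReal (-Real.log q.toReal)

theorem info_anti {a b : ℝ≥0∞} (ha : a ≠ 0) (hb : b ≠ ∞) (hab : a ≤ b) : info b ≤ info a := by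
  refine ENNReal.ofReal_le_ofReal (neg_le_neg ?_)
  exact Real.log_le_log (ENNReal.toReal_pos ha (ne_top_of_le_ne_top hb hab))
    (ENNReal.toReal_mono hb hab)

theorem info_eq_ofReal {r : ℝ} (hr : 0 ≤ r) :
    info (ENNReal.ofReal r) = ENNReal.ofReal (-Real.log r) := by
  rw [info, ENNReal.toReal_ofReal hr]

theorem exists_ofReal {a : ℝ≥0∞} (h0 : a ≠ 0) (h1 : a ≤ 1) :
    ∃ r : ℝ, 0 < r ∧ r ≤ 1 ∧ a = ENNReal.ofReal r := by
  have ht : a ≠ ∞ := ne_top_of_le_ne_top ENNReal.one_ne_top h1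
  refine ⟨a.toReal, ENNReal.toReal_pos h0 ht, ?_, (ENNReal.ofReal_toReal ht).symm⟩
  simpa using ENNReal.toReal_mono ENNReal.one_ne_top h1

theorem info_mul {a b : ℝ≥0∞} (ha : a ≠ 0) (ha1 : a ≤ 1) (hb : b ≠ 0) (hb1 : b ≤ 1) :
    info (a * b) = info a + info b := by
  obtain ⟨r, hr, hr1, rfl⟩ := exists_ofReal ha ha1
  obtain ⟨s, hs, hs1, rfl⟩ := exists_ofReal hb hb1
  rw [← ENNReal.ofReal_mul hr.le, info_eq_ofReal (by positivity), info_eq_ofReal hr.le,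
    info_eq_ofReal hs.le, ← ENNReal.ofReal_add, Real.log_mul hr.ne' hs.ne']
  · congr 1; ring
  · linarith [Real.log_nonpos hr.le hr1]
  · linarith [Real.log_nonpos hs.le hs1]

/-- The inequality `log t ≤ t - 1` at `t = b * c / (a * e)`. -/
theorem info_add_info_add_one_le {a b c e : ℝ≥0∞} (ha₀ : a ≠ 0) (ha₁ : a ≤ 1) (hb₀ : b ≠ 0)
    (hb₁ : b ≤ 1) (hc₀ : c ≠ 0) (hc₁ : c ≤ 1) (he₀ : e ≠ 0) (he₁ : e ≤ 1) :
    info a + info e + 1 ≤ info b + info c + b * c / (a * e) := by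
  obtain ⟨a, ha, ha1, rfl⟩ := exists_ofReal ha₀ ha₁
  obtain ⟨b, hb, hb1, rfl⟩ := exists_ofReal hb₀ hb₁
  obtain ⟨c, hc, hc1, rfl⟩ := exists_ofReal hc₀ hc₁
  obtain ⟨e, he, he1, rfl⟩ := exists_ofReal he₀ he₁
  have hae : 0 < a * e := by positivity
  have la := Real.log_nonpos ha.le ha1
  have lb := Real.log_nonpos hb.le hb1
  have lc := Real.log_nonpos hc.le hc1
  have le := Real.log_nonpos he.le he1
  have ht : 0 < b * c / (a * e) := by positivity
  rw [info_eq_ofReal ha.le, info_eq_ofReal hb.le, info_eq_ofReal hc.le, info_eq_ofReal he.le,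
    ← ENNReal.ofReal_mul hb.le, ← ENNReal.ofReal_mul ha.le, ← ENNReal.ofReal_div_of_pos hae,
    ← ENNReal.ofReal_one, ← ENNReal.ofReal_add (by linarith) (by linarith),
    ← ENNReal.ofReal_add (by linarith) zero_le_one,
    ← ENNReal.ofReal_add (by linarith) (by linarith), ← ENNReal.ofReal_add (by linarith) ht.le]
  refine ENNReal.ofReal_le_ofReal ?_
  have h := Real.log_le_sub_one_of_pos ht
  rw [Real.log_div (by positivity) hae.ne', Real.log_mul hb.ne' hc.ne',
    Real.log_mul ha.ne' he.ne'] at h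
  linarith

/-- Averaging over `Ω` rather than over values lets entropies of variables with different ranges be
compared pointwise in `ω`. -/
theorem entropy_eq_tsum (p : PMF Ω) (X : Ω → α) :
    entropy p X = ∑' ω, p ω * info (p.map X (X ω)) := by
  rw [← tsum_map_mul p X fun x => info (p.map X x), entropy]
  refine tsum_congr fun x => ?_
  rw [Real.negMulLog, neg_mul_comm, ENNReal.ofReal_mul ENNReal.toReal_nonneg,
    ENNReal.ofReal_toReal ((p.map X).apply_ne_top x), info]

/-- Up to null points, the fibre of `X` through `ω` lies inside the fibre of `Y` through `ω`. -/
theorem map_apply_le_of_determines {p : PMF Ω} {X : Ω → α} {Y : Ω → β} (h : Determines p X Y)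
    {ω : Ω} (hω : p ω ≠ 0) : p.map X (X ω) ≤ p.map Y (Y ω) := by
  obtain ⟨g, hg⟩ := h
  rw [PMF.map_apply, PMF.map_apply]
  refine ENNReal.tsum_le_tsum fun ω' => ?_
  by_cases h0 : p ω' = 0
  · simp [h0]
  · by_cases hX : X ω = X ω'
    · have : Y ω = Y ω' := by
        rw [hg ω ((PMF.mem_support_iff _ _).2 hω), hg ω' ((PMF.mem_support_iff _ _).2 h0), hX]
      simp [hX, this]
    · simp [hX]

theorem entropy_le_of_determines {p : PMF Ω} {X : Ω → α} {Y : Ω → β} (h : Determines p X Y) :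
    entropy p Y ≤ entropy p X := by
  rw [entropy_eq_tsum, entropy_eq_tsum]
  refine ENNReal.tsum_le_tsum fun ω => ?_
  by_cases h0 : p ω = 0
  · simp [h0]
  · exact mul_le_mul_right (info_anti (map_apply_self_ne_zero p X h0) ((p.map Y).apply_ne_top _)
      (map_apply_le_of_determines h h0)) _

theorem entropy_pair_of_indep {p : PMF Ω} {X : Ω → α} {Y : Ω → β} (h : Indep p X Y) :
    entropy p (fun ω => (X ω, Y ω)) = entropy p X + entropy p Y := by
  rw [entropy_eq_tsum, entropy_eq_tsum, entropy_eq_tsum, ← ENNReal.tsum_add]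
  refine tsum_congr fun ω => ?_
  by_cases h0 : p ω = 0
  · simp [h0]
  · rw [h, info_mul (map_apply_self_ne_zero p X h0) (PMF.coe_le_one _ _)
      (map_apply_self_ne_zero p Y h0) (PMF.coe_le_one _ _), mul_add]

/-- With `Z = g(X) = h(Y)`, the ratio compares the law that makes `X` and `Y` conditionally
independent given `Z` with the true joint law. Its mean is at most the total mass of the former. -/
theorem tsum_mul_density_le_one (p : PMF Ω) (X : Ω → α) (Y : Ω → β) (g : α → γ) (h : β → γ)
    (hgh : ∀ ω, g (X ω) = h (Y ω)) :
    ∑' ω, p ω * (p.map X (X ω) * p.map Y (Y ω) /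
      (p.map (fun ω => (X ω, Y ω)) (X ω, Y ω) * p.map (fun ω => g (X ω)) (g (X ω)))) ≤ 1 := by
  classical
  have key : ∀ x, ∑' y, (if g x = h y then p.map Y y else 0) =
      p.map (fun ω => g (X ω)) (g x) := by
    intro x
    have : p.map (fun ω => g (X ω)) = (p.map Y).map h := by
      rw [PMF.map_comp]
      congr 1
      exact funext hgh
    rw [this, PMF.map_apply]
  rw [← tsum_map_mul p (fun ω => (X ω, Y ω)) fun z => p.map X z.1 * p.map Y z.2 /
      (p.map (fun ω => (X ω, Y ω)) z * p.map (fun ω => g (X ω)) (g z.1))]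
  -- The joint law lives on the pairs with `g x = h y`; the sum is enlarged to all such pairs, after
  -- which `key` evaluates the sum over `y`.
  calc _ ≤ ∑' z : α × β, p.map X z.1 / p.map (fun ω => g (X ω)) (g z.1) *
          (if g z.1 = h z.2 then p.map Y z.2 else 0) := by
        refine ENNReal.tsum_le_tsum fun z => ?_
        by_cases h0 : p.map (fun ω => (X ω, Y ω)) z = 0
        · simp [h0]
        · have hz := (PMF.mem_support_iff _ _).2 h0
          rw [PMF.mem_support_map_iff] at hz
          obtain ⟨ω, -, rfl⟩ := hz
          dsimp only
          rw [if_pos (hgh ω), ENNReal.div_eq_inv_mul, ENNReal.mul_inv (Or.inl h0)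
            (Or.inl (PMF.apply_ne_top _ _)), ← mul_assoc, ← mul_assoc, ← mul_assoc,
            ENNReal.mul_inv_cancel h0 (PMF.apply_ne_top _ _), one_mul, div_eq_mul_inv]
          apply le_of_eq
          ring
    _ = ∑' x, p.map X x / p.map (fun ω => g (X ω)) (g x) * p.map (fun ω => g (X ω)) (g x) := by
        rw [ENNReal.tsum_prod']
        refine tsum_congr fun x => ?_
        dsimp only
        rw [ENNReal.tsum_mul_left, key x]
    _ ≤ ∑' x, p.map X x := ENNReal.tsum_le_tsum fun x => by
        rw [mul_comm]
        exact ENNReal.mul_div_le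
    _ = 1 := PMF.tsum_coe _

/-- Submodularity of entropy: if `Z` is a function of `X` and also a function of `Y`, then
`H(X, Y) + H(Z) ≤ H(X) + H(Y)`. -/
theorem entropy_pair_add_le (p : PMF Ω) (X : Ω → α) (Y : Ω → β) (g : α → γ) (h : β → γ)
    (hgh : ∀ ω, g (X ω) = h (Y ω)) :
    entropy p (fun ω => (X ω, Y ω)) + entropy p (fun ω => g (X ω)) ≤
      entropy p X + entropy p Y := by
  -- The `1` replaces the `-1` of `log t ≤ t - 1`, since subtraction in `[0, ∞]` is truncated. On
  -- the left it is the total mass of `p`; on the right it bounds the mean of the density ratio.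
  have hle : entropy p (fun ω => (X ω, Y ω)) + entropy p (fun ω => g (X ω)) + 1 ≤
      entropy p X + entropy p Y + 1 := by
    refine le_trans ?_ (add_le_add_right (tsum_mul_density_le_one p X Y g h hgh) _)
    rw [entropy_eq_tsum, entropy_eq_tsum, entropy_eq_tsum, entropy_eq_tsum, ← p.tsum_coe,
      ← ENNReal.tsum_add, ← ENNReal.tsum_add, ← ENNReal.tsum_add, ← ENNReal.tsum_add]
    refine ENNReal.tsum_le_tsum fun ω => ?_
    by_cases h0 : p ω = 0
    · simp [h0]
    · have := info_add_info_add_one_le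
        (map_apply_self_ne_zero p (fun ω => (X ω, Y ω)) h0) (PMF.coe_le_one _ _)
        (map_apply_self_ne_zero p X h0) (PMF.coe_le_one _ _)
        (map_apply_self_ne_zero p Y h0) (PMF.coe_le_one _ _)
        (map_apply_self_ne_zero p (fun ω => g (X ω)) h0) (PMF.coe_le_one _ _)
      simpa [mul_add] using mul_le_mul_right this (p ω)
  exact (ENNReal.add_le_add_iff_right ENNReal.one_ne_top).1 hle

theorem entropy_le_log_card [Fintype α] (p : PMF Ω) (X : Ω → α) :
    entropy p X ≤ ENNReal.ofReal (Real.log (Fintype.card α)) := by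
  obtain ⟨ω₀, -⟩ := p.support_nonempty
  have : Nonempty α := ⟨X ω₀⟩
  have hn : (1 : ℝ) ≤ Fintype.card α := by exact_mod_cast Fintype.card_pos
  set n : ℝ := (Fintype.card α : ℝ) with hn'
  have hsum : ∑' _ : α, ENNReal.ofReal (1 / n) = 1 := by
    rw [tsum_fintype, Finset.sum_const, Finset.card_univ, nsmul_eq_mul,
      ← ENNReal.ofReal_natCast, ← ENNReal.ofReal_mul (by positivity), ← hn',
      mul_one_div_cancel (by positivity), ENNReal.ofReal_one]
  have hle : entropy p X + 1 ≤ ENNReal.ofReal (Real.log n) + 1 := by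
    have e1 : entropy p X + 1 = ∑' x, (p.map X x * info (p.map X x) + p.map X x) := by
      rw [ENNReal.tsum_add, PMF.tsum_coe, tsum_map_mul p X fun x => info (p.map X x),
        ← entropy_eq_tsum]
    have e2 : ENNReal.ofReal (Real.log n) + 1 =
        ∑' x, (p.map X x * ENNReal.ofReal (Real.log n) + ENNReal.ofReal (1 / n)) := by
      rw [ENNReal.tsum_add, ENNReal.tsum_mul_right, PMF.tsum_coe, one_mul, hsum]
    rw [e1, e2]
    refine ENNReal.tsum_le_tsum fun x => ?_
    by_cases h0 : p.map X x = 0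
    · simp [h0]
    · obtain ⟨r, hr, hr1, h⟩ := exists_ofReal h0 (PMF.coe_le_one _ _)
      have l1 := Real.log_nonpos hr.le hr1
      have l2 := Real.log_nonneg hn
      rw [h, info_eq_ofReal hr.le, ← ENNReal.ofReal_mul hr.le, ← ENNReal.ofReal_mul hr.le,
        ← ENNReal.ofReal_add (mul_nonneg hr.le (by linarith)) hr.le,
        ← ENNReal.ofReal_add (by positivity) (by positivity)]
      refine ENNReal.ofReal_le_ofReal ?_
      -- Comparison with the uniform law: `t` is the uniform weight `1 / n` divided by the actual
      -- weight `r`.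
      have h := Real.log_le_sub_one_of_pos (show 0 < 1 / n / r by positivity)
      rw [Real.log_div (by positivity) hr.ne', Real.log_div one_ne_zero (by positivity),
        Real.log_one] at h
      have h' := mul_le_mul_of_nonneg_left h hr.le
      rw [mul_sub r (1 / n / r), mul_div_cancel₀ _ hr.ne'] at h'
      linarith
  exact (ENNReal.add_le_add_iff_right ENNReal.one_ne_top).1 hle

end Entropy

/-! ### The entropy polymatroid of a scheme -/

/-- The properties of the normalised entropy function of a perfect secret sharing scheme that are
used to bound information ratios from below. -/
structure IsSecretPolymatroid {V : Type} (𝒜 : Set (Set V)) (f : Set V → ℝ) : Prop where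
  nonneg : ∀ A, 0 ≤ f A
  mono : ∀ {A B}, A ⊆ B → f A ≤ f B
  submod : ∀ A B, f (A ∪ B) + f (A ∩ B) ≤ f A + f B
  strict_mono : ∀ {A B}, A ⊆ B → A ∉ 𝒜 → B ∈ 𝒜 → f A + 1 ≤ f B
  strict_submod : ∀ {A B}, A ∈ 𝒜 → B ∈ 𝒜 → A ∩ B ∉ 𝒜 → f (A ∪ B) + f (A ∩ B) + 1 ≤ f A + f B

namespace PerfectScheme

variable {V : Type} {𝒜 : Set (Set V)} (S : PerfectScheme 𝒜)

/-- The joint entropy of the shares of `A` and of a further random variable `T`. -/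
noncomputable def entropyWith {τ : Type} (T : S.Ω → τ) (A : Set V) : ℝ≥0∞ :=
  entropy S.p fun ω => (fun i : A => S.share i ω, T ω)

theorem entropyWith_mono {τ : Type} (T : S.Ω → τ) {A B : Set V} (h : A ⊆ B) :
    S.entropyWith T A ≤ S.entropyWith T B :=
  entropy_le_of_determines
    ⟨fun z => (fun i : A => z.1 ⟨i.1, h i.2⟩, z.2), fun _ _ => rfl⟩

/-- The pairs (shares of `A`, `T`) and (shares of `B`, `T`) have (shares of `A ∩ B`, `T`) as a
common function, and together they determine the shares of `A ∪ B`. -/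
theorem entropyWith_submod {τ : Type} (T : S.Ω → τ) (A B : Set V) :
    S.entropyWith T (A ∪ B) + S.entropyWith T (A ∩ B) ≤
      S.entropyWith T A + S.entropyWith T B := by
  classical
  refine le_trans (add_le_add_left ?_ _) (entropy_pair_add_le S.p
    (fun ω => (fun i : A => S.share i ω, T ω)) (fun ω => (fun i : B => S.share i ω, T ω))
    (fun z => (fun i : ↥(A ∩ B) => z.1 ⟨i.1, i.2.1⟩, z.2))
    (fun z => (fun i : ↥(A ∩ B) => z.1 ⟨i.1, i.2.2⟩, z.2)) fun ω => rfl)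
  refine entropy_le_of_determines ⟨fun z => (fun i : ↥(A ∪ B) =>
    if h : i.1 ∈ A then z.1.1 ⟨i.1, h⟩ else z.2.1 ⟨i.1, i.2.resolve_left h⟩, z.1.2), ?_⟩
  intro ω _
  refine Prod.ext (funext fun i => ?_) rfl
  by_cases h : i.1 ∈ A <;> simp [h]

/-- The joint entropy of the shares of `A`. -/
noncomputable def jointEntropy (A : Set V) : ℝ≥0∞ :=
  S.entropyWith (fun _ => ()) A

theorem jointEntropy_eq (A : Set V) :
    S.jointEntropy A = entropy S.p fun ω (i : A) => S.share i ω :=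
  le_antisymm (entropy_le_of_determines ⟨fun z => (z, ()), fun _ _ => rfl⟩)
    (entropy_le_of_determines ⟨fun z => z.1, fun _ _ => rfl⟩)

theorem entropyWith_secret_of_mem {A : Set V} (hA : A ∈ 𝒜) :
    S.entropyWith S.secret A = S.jointEntropy A := by
  rw [jointEntropy_eq]
  refine le_antisymm (entropy_le_of_determines ?_)
    (entropy_le_of_determines ⟨fun z => z.1, fun _ _ => rfl⟩)
  obtain ⟨g, hg⟩ := S.correct A hA
  exact ⟨fun z => (z, g z), fun ω hω => Prod.ext rfl (hg ω hω)⟩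

theorem entropyWith_secret_of_notMem {A : Set V} (hA : A ∉ 𝒜) :
    S.entropyWith S.secret A = S.jointEntropy A + entropy S.p S.secret := by
  rw [jointEntropy_eq]
  exact entropy_pair_of_indep (S.perfect A hA)

theorem jointEntropy_add_entropy_secret_le {A B : Set V} (h : A ⊆ B) (hA : A ∉ 𝒜) (hB : B ∈ 𝒜) :
    S.jointEntropy A + entropy S.p S.secret ≤ S.jointEntropy B := by
  rw [← S.entropyWith_secret_of_mem hB, ← S.entropyWith_secret_of_notMem hA]
  exact S.entropyWith_mono _ h

/-- Adjoin the secret to all four terms of submodularity: it is free for `A`, `B` and `A ∪ B`, which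
determine it, and costs its full entropy for `A ∩ B`, which is independent of it. -/
theorem jointEntropy_strict_submod (mono : IsUpperSet 𝒜) {A B : Set V} (hA : A ∈ 𝒜) (hB : B ∈ 𝒜)
    (hAB : A ∩ B ∉ 𝒜) :
    S.jointEntropy (A ∪ B) + S.jointEntropy (A ∩ B) + entropy S.p S.secret ≤
      S.jointEntropy A + S.jointEntropy B := by
  rw [← S.entropyWith_secret_of_mem hA, ← S.entropyWith_secret_of_mem hB,
    ← S.entropyWith_secret_of_mem (mono Set.subset_union_left hA), add_assoc,
    ← S.entropyWith_secret_of_notMem hAB]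
  exact S.entropyWith_submod _ A B

theorem jointEntropy_singleton_le (v : V) : S.jointEntropy {v} ≤ entropy S.p (S.share v) := by
  rw [jointEntropy_eq]
  refine entropy_le_of_determines
    ⟨fun x i => cast (congrArg S.Share (Set.mem_singleton_iff.1 i.2).symm) x, fun ω _ => ?_⟩
  funext ⟨i, hi⟩
  obtain rfl := Set.mem_singleton_iff.1 hi
  rfl

theorem jointEntropy_ne_top [Finite V] (h : ∀ v, entropy S.p (S.share v) ≠ ∞) (A : Set V) :
    S.jointEntropy A ≠ ∞ := by
  induction A, A.toFinite using Set.Finite.induction_on with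
  | empty =>
    rw [jointEntropy_eq]
    -- The tuple of shares of the empty set ranges over a one-point type.
    refine ne_top_of_le_ne_top ENNReal.ofReal_ne_top (entropy_le_log_card S.p _)
  | @insert a s _ _ ih =>
    have h1 := S.entropyWith_submod (fun _ => ()) {a} s
    rw [Set.singleton_union] at h1
    exact ne_top_of_le_ne_top (ENNReal.add_ne_top.2
      ⟨ne_top_of_le_ne_top (h a) (S.jointEntropy_singleton_le a), ih⟩) (le_self_add.trans h1)

theorem isSecretPolymatroid [Finite V] (mono : IsUpperSet 𝒜)
    (h : ∀ v, entropy S.p (S.share v) ≠ ∞) :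
    IsSecretPolymatroid 𝒜
      fun A => (S.jointEntropy A).toReal / (entropy S.p S.secret).toReal := by
  have fin := S.jointEntropy_ne_top h
  have hs := S.entropy_secret_ne_top
  have hpos : 0 < (entropy S.p S.secret).toReal := ENNReal.toReal_pos S.entropy_secret_ne_zero hs
  refine ⟨fun A => by positivity, fun {A B} hAB => ?_, fun A B => ?_, fun {A B} hAB hA hB => ?_,
    fun {A B} hA hB hAB => ?_⟩
  · exact div_le_div_of_nonneg_right (ENNReal.toReal_mono (fin B) (S.entropyWith_mono _ hAB))
      hpos.le
  · rw [← add_div, ← add_div, ← ENNReal.toReal_add (fin _) (fin _),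
      ← ENNReal.toReal_add (fin _) (fin _)]
    exact div_le_div_of_nonneg_right (ENNReal.toReal_mono (ENNReal.add_ne_top.2 ⟨fin _, fin _⟩)
      (S.entropyWith_submod _ A B)) hpos.le
  · rw [← div_self hpos.ne', ← add_div, ← ENNReal.toReal_add (fin _) hs]
    exact div_le_div_of_nonneg_right (ENNReal.toReal_mono (fin B)
      (S.jointEntropy_add_entropy_secret_le hAB hA hB)) hpos.le
  · rw [← div_self hpos.ne', ← add_div, ← add_div, ← add_div, ← ENNReal.toReal_add (fin _) (fin _),
      ← ENNReal.toReal_add (fin _) (fin _),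
      ← ENNReal.toReal_add (ENNReal.add_ne_top.2 ⟨fin _, fin _⟩) hs]
    exact div_le_div_of_nonneg_right (ENNReal.toReal_mono (ENNReal.add_ne_top.2 ⟨fin _, fin _⟩)
      (S.jointEntropy_strict_submod mono hA hB hAB)) hpos.le

/-- A lower bound valid for the singletons in every polymatroid of the access structure is a lower
bound for the largest information ratio. -/
theorem le_iSup_ratio [Finite V] (mono : IsUpperSet 𝒜) {r : ℝ}
    (hr : ∀ f, IsSecretPolymatroid 𝒜 f → ∃ v, r ≤ f {v}) :
    ENNReal.ofReal r ≤ ⨆ v, S.ratio v := by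
  have hs := S.entropy_secret_ne_top
  by_cases h : ∀ v, entropy S.p (S.share v) ≠ ∞
  · obtain ⟨v, hv⟩ := hr _ (S.isSecretPolymatroid mono h)
    refine le_trans ?_ (le_iSup _ v)
    rw [← ENNReal.toReal_div] at hv
    refine (ENNReal.ofReal_le_ofReal hv).trans (ENNReal.ofReal_toReal_le.trans ?_)
    exact ENNReal.div_le_div_right (S.jointEntropy_singleton_le v) _
  -- A share of infinite entropy makes the ratio infinite, because the secret has finite entropy.
  · push Not at h
    obtain ⟨v, hv⟩ := h
    refine le_trans le_top (le_trans (le_of_eq ?_) (le_iSup _ v))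
    rw [ratio, hv, ENNReal.top_div_of_ne_top hs]

end PerfectScheme

/-! ### The cube and its bipartition -/

/-- The neighbour of the word `x` in direction `i`. -/
def flipAt {d : ℕ} (i : Fin d) (x : Fin d → Bool) : Fin d → Bool :=
  Function.update x i (!x i)

section Cube

variable {d : ℕ}

@[simp]
theorem flipAt_same (i : Fin d) (x : Fin d → Bool) : flipAt i x i = !x i := by
  simp [flipAt]

theorem flipAt_of_ne {i j : Fin d} (h : j ≠ i) (x : Fin d → Bool) : flipAt i x j = x j := by
  simp [flipAt, h]

@[simp]
theorem flipAt_flipAt (i : Fin d) (x : Fin d → Bool) : flipAt i (flipAt i x) = x := by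
  simp [flipAt]

theorem flipAt_injective_left (x : Fin d → Bool) : Function.Injective fun i => flipAt i x := by
  intro i j h
  by_contra hij
  have h1 := congrFun h i
  simp only [flipAt_same, flipAt_of_ne hij] at h1
  exact Bool.not_ne_self _ h1

theorem cube_adj_iff {x y : Fin d → Bool} : (cube d).Adj x y ↔ ∃ i, y = flipAt i x := by
  change hammingDist x y = 1 ↔ _
  rw [hammingDist, Finset.card_eq_one]
  refine exists_congr fun i => ?_
  simp only [Finset.ext_iff, Finset.mem_filter_univ, Finset.mem_singleton, funext_iff]
  refine forall_congr' fun j => ?_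
  by_cases h : j = i
  · subst h
    simp only [flipAt_same]
    cases x j <;> cases y j <;> simp
  · simp [flipAt_of_ne h, h, eq_comm]

theorem cube_adj_flipAt (i : Fin d) (x : Fin d → Bool) : (cube d).Adj x (flipAt i x) :=
  cube_adj_iff.2 ⟨i, rfl⟩

/-- The parity of the number of ones in a word. -/
def parity (x : Fin d → Bool) : Bool := decide (Odd (∑ i, (x i).toNat))

theorem parity_flipAt (i : Fin d) (x : Fin d → Bool) : parity (flipAt i x) = !parity x := by
  -- Subtraction-free form of the change at `i`: a bit `b` satisfies `b + 1 = (1 - b) + 2 * b`.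
  have h : ∑ j, (x j).toNat + 1 = ∑ j, (flipAt i x j).toNat + 2 * (x i).toNat := by
    rw [← Finset.add_sum_erase _ _ (Finset.mem_univ i),
      ← Finset.add_sum_erase _ (fun j => (flipAt i x j).toNat) (Finset.mem_univ i),
      Finset.sum_congr rfl fun j hj => by rw [← flipAt_of_ne (Finset.ne_of_mem_erase hj) x]]
    simp only [flipAt_same]
    cases x i <;> simp <;> ring
  unfold parity
  rw [← decide_not, decide_eq_decide, Nat.odd_iff, Nat.odd_iff]
  omega

theorem parity_ne_of_adj {x y : Fin d → Bool} (h : (cube d).Adj x y) : parity x ≠ parity y := by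
  obtain ⟨i, rfl⟩ := cube_adj_iff.1 h
  rw [parity_flipAt]
  exact (Bool.not_ne_self _).symm

end Cube

/-! ### The lower bound -/

theorem isUpperSet_accessStructure {V : Type} (G : SimpleGraph V) :
    IsUpperSet (accessStructure G) := by
  rintro A B hAB ⟨u, hu, v, hv, h⟩
  exact ⟨u, hAB hu, v, hAB hv, h⟩

/-- The increment of `f` when `v` is added to `S`; for the entropy function it is the conditional
entropy of the share of `v` given those of `S`. -/
def increment {V : Type} (f : Set V → ℝ) (v : V) (S : Set V) : ℝ := f (insert v S) - f S

section Increment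

variable {V : Type} {𝒜 : Set (Set V)} {f : Set V → ℝ}

theorem increment_add_increment (f : Set V → ℝ) (u v : V) (S : Set V) :
    increment f u S + increment f v (insert u S) =
      increment f v S + increment f u (insert v S) := by
  unfold increment
  rw [Set.insert_comm]
  ring

theorem IsSecretPolymatroid.increment_anti (hf : IsSecretPolymatroid 𝒜 f) (v : V) {S T : Set V}
    (h : S ⊆ T) : increment f v T ≤ increment f v S := by
  unfold increment
  by_cases hv : v ∈ T
  · rw [Set.insert_eq_of_mem hv]
    linarith [hf.mono (Set.subset_insert v S)]
  · have := hf.submod (insert v S) T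
    rw [Set.insert_union, Set.union_eq_right.2 h, Set.insert_inter_of_notMem hv,
      Set.inter_eq_left.2 h] at this
    linarith

/-- Strict submodularity for `insert v S` and `T`: both are qualified, while their intersection `S`
is not. -/
theorem IsSecretPolymatroid.increment_strict_anti (hf : IsSecretPolymatroid 𝒜 f) {v : V}
    {S T : Set V} (h : S ⊆ T) (hv : v ∉ T) (hS : S ∉ 𝒜) (hvS : insert v S ∈ 𝒜) (hT : T ∈ 𝒜) :
    increment f v T + 1 ≤ increment f v S := by
  unfold increment
  have e : insert v S ∩ T = S := by rw [Set.insert_inter_of_notMem hv, Set.inter_eq_left.2 h]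
  have := hf.strict_submod hvS hT (by rwa [e])
  rw [Set.insert_union, Set.union_eq_right.2 h, e] at this
  linarith

theorem IsSecretPolymatroid.one_le_increment (hf : IsSecretPolymatroid 𝒜 f) {v : V} {S : Set V}
    (hS : S ∉ 𝒜) (hvS : insert v S ∈ 𝒜) : 1 ≤ increment f v S := by
  unfold increment
  linarith [hf.strict_mono (Set.subset_insert v S) hS hvS]

end Increment

/-! ### Increments along nested subcubes -/

section LowerBound

variable {d : ℕ}

/-- In the subcube of the words that agree with `v` outside of the first `k` coordinates: the odd
vertices other than `v`, and the leaves attached to the even vertices. -/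
def condSet (k : ℕ) (v : Fin d → Bool) : Set ((Fin d → Bool) ⊕ (Fin d → Bool))
  | .inl u => parity u = true ∧ u ≠ v ∧ ∀ i : Fin d, k ≤ i → u i = v i
  | .inr u => parity u = false ∧ ∀ i : Fin d, k ≤ i → u i = v i

theorem inl_mem_condSet {k : ℕ} {u v : Fin d → Bool} : .inl u ∈ condSet k v ↔
    parity u = true ∧ u ≠ v ∧ ∀ i : Fin d, k ≤ i → u i = v i := Iff.rfl

theorem inr_mem_condSet {k : ℕ} {u v : Fin d → Bool} : .inr u ∈ condSet k v ↔
    parity u = false ∧ ∀ i : Fin d, k ≤ i → u i = v i := Iff.rfl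

theorem flipAt_agree (i : Fin d) (v : Fin d → Bool) (j : Fin d) (hj : (i : ℕ) + 1 ≤ j) :
    flipAt i v j = v j :=
  flipAt_of_ne (fun h => by subst h; omega) v

theorem condSet_subset_succ (k : ℕ) (v : Fin d → Bool) : condSet k v ⊆ condSet (k + 1) v := by
  rintro (u | u) h
  · exact ⟨h.1, h.2.1, fun i hi => h.2.2 i (by omega)⟩
  · exact ⟨h.1, fun i hi => h.2 i (by omega)⟩

/-- Both endpoints of an edge in direction `i` see the same subcube at level `i + 1`. The sets
differ only because the odd endpoint is left out of its own set. -/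
theorem insert_flipAt_condSet (i : Fin d) {a : Fin d → Bool} (ha : parity a = false) :
    insert (.inl (flipAt i a)) (condSet (i + 1) (flipAt i a)) = condSet (i + 1) a := by
  have h' : parity (flipAt i a) = true := by rw [parity_flipAt, ha]; rfl
  ext (u | u)
  · simp only [Set.mem_insert_iff, Sum.inl.injEq, inl_mem_condSet]
    constructor
    · rintro (rfl | ⟨h1, -, h3⟩)
      · exact ⟨h', (cube_adj_flipAt i a).ne', flipAt_agree i a⟩
      · refine ⟨h1, fun h => ?_, fun j hj => (h3 j hj).trans (flipAt_agree i a j hj)⟩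
        rw [h, ha] at h1
        exact absurd h1 (by decide)
    · rintro ⟨h1, -, h3⟩
      by_cases h : u = flipAt i a
      · exact Or.inl h
      · exact Or.inr ⟨h1, h, fun j hj => (h3 j hj).trans (flipAt_agree i a j hj).symm⟩
  · simp only [Set.mem_insert_iff, reduceCtorEq, false_or, inr_mem_condSet]
    exact and_congr_right fun _ => forall₂_congr fun j hj => by rw [flipAt_agree i a j hj]

/-- Let `b` be the odd endpoint and `C = condSet (i + 1) b`. The level `i + 1` increments add `b` to
`C` and then `a`. Exchanging the order, `a` is added to `C`, which contains `condSet i a`, and then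
`b` to `C ∪ {a}`, where strict submodularity supplies the gain of 1. -/
theorem increment_condSet_step {f : Set ((Fin d → Bool) ⊕ (Fin d → Bool)) → ℝ}
    (hf : IsSecretPolymatroid (accessStructure (cubeStar d)) f) (i : Fin d) {a : Fin d → Bool}
    (ha : parity a = false) :
    increment f (.inl a) (condSet (i + 1) a) +
        increment f (.inl (flipAt i a)) (condSet (i + 1) (flipAt i a)) + 1 ≤
      increment f (.inl a) (condSet i a) +
        increment f (.inl (flipAt i a)) (condSet i (flipAt i a)) := by
  have hb : parity (flipAt i a) = true := by rw [parity_flipAt, ha]; rfl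
  have hT := insert_flipAt_condSet i ha
  have hbT : Sum.inl (flipAt i a) ∉ condSet (i + 1) (flipAt i a) := fun h => h.2.1 rfl
  have hsub := condSet_subset_succ (i : ℕ) (flipAt i a)
  generalize hb' : flipAt i a = b at *
  have hab : (cube d).Adj a b := hb' ▸ cube_adj_flipAt i a
  have hsub' : condSet (i : ℕ) a ⊆ condSet (i + 1) b := by
    intro w hw
    have h1 := condSet_subset_succ _ _ hw
    rw [← hT] at h1
    refine h1.resolve_left ?_
    rintro rfl
    have := hw.2.2 i le_rfl
    rw [← hb', flipAt_same] at this
    exact Bool.not_ne_self _ this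
  have hstrict : increment f (.inl b) (insert (.inl a) (condSet (i + 1) b)) + 1 ≤
      increment f (.inl b) (insert (.inl a) (condSet (i : ℕ) b)) := by
    refine hf.increment_strict_anti (Set.insert_subset_insert hsub) ?_ ?_ ?_ ?_
    · rintro (h | h)
      · exact hab.ne' (Sum.inl_injective h)
      · exact hbT h
    -- `condSet i b` lies over the half of the subcube opposite to `a`, where the only neighbour of
    -- `a` is `b`, which is excluded. Hence adding `a` keeps the set independent.
    · have key : ∀ w ∈ condSet (i : ℕ) b, ¬ (cubeStar d).Adj (.inl a) w := by
        rintro (u | u) hu h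
        · obtain ⟨j, rfl⟩ := cube_adj_iff.1 h
          have h1 := hu.2.2 i le_rfl
          by_cases hij : i = j
          · subst hij
            exact hu.2.1 hb'
          · rw [flipAt_of_ne hij, ← hb', flipAt_same] at h1
            exact Bool.not_ne_self _ h1.symm
        · have h1 := hu.2 i le_rfl
          rw [← show a = u from h, ← hb', flipAt_same] at h1
          exact Bool.not_ne_self _ h1.symm
      rintro ⟨w, hw, z, hz, h⟩
      rcases hw with rfl | hw
      · rcases hz with rfl | hz
        · exact (cubeStar d).irrefl h
        · exact key z hz h
      · rcases hz with rfl | hz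
        · exact key w hw h.symm
        · rcases w with u | u <;> rcases z with v | v
          · exact parity_ne_of_adj h (hw.1.trans hz.1.symm)
          · have huv : u = v := h
            exact absurd (hw.1.symm.trans (huv ▸ hz.1)) (by decide)
          · have huv : u = v := h
            exact absurd (hz.1.symm.trans (huv ▸ hw.1)) (by decide)
          · exact h
    · exact ⟨.inl b, Set.mem_insert _ _, .inl a, by simp, hab.symm⟩
    -- The larger set is qualified through the pendant edge at `a`: since `a` is even, its leaf is
    -- in `condSet (i + 1) b`.
    · exact ⟨.inl a, Set.mem_insert _ _, .inr a, Or.inr (hsub' ⟨ha, fun _ _ => rfl⟩), rfl⟩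
  have h1 := hf.increment_anti (.inl a) hsub'
  have h2 := hf.increment_anti (.inl b) (Set.subset_insert (.inl a) (condSet (i : ℕ) b))
  have h3 := increment_add_increment f (.inl a) (.inl b) (condSet (i + 1) b)
  rw [hT] at h3
  linarith

theorem sum_increment_condSet_step {f : Set ((Fin d → Bool) ⊕ (Fin d → Bool)) → ℝ}
    (hf : IsSecretPolymatroid (accessStructure (cubeStar d)) f) (i : Fin d) :
    ∑ v, increment f (.inl v) (condSet (i + 1) v) + 2 ^ d / 2 ≤
      ∑ v, increment f (.inl v) (condSet i v) := by
  have hflip : ∀ F : (Fin d → Bool) → ℝ, ∑ v, F (flipAt i v) = ∑ v, F v := fun F =>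
    Equiv.sum_comp (Function.Involutive.toPerm (flipAt i) (flipAt_flipAt i)) F
  -- Summing over all `v` counts each edge of direction `i` from both ends, hence the gain `2 ^ d /
  -- 2` after halving.
  have h := Finset.sum_le_sum fun (v : Fin d → Bool) (_ : v ∈ Finset.univ) =>
    show increment f (.inl v) (condSet (i + 1) v) +
        increment f (.inl (flipAt i v)) (condSet (i + 1) (flipAt i v)) + 1 ≤
      increment f (.inl v) (condSet i v) +
        increment f (.inl (flipAt i v)) (condSet i (flipAt i v)) by
      cases hv : parity v
      · exact increment_condSet_step hf i hv
      · have := increment_condSet_step hf i (a := flipAt i v) (by rw [parity_flipAt, hv]; rfl)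
        rw [flipAt_flipAt] at this
        linarith
  simp only [Finset.sum_add_distrib] at h
  rw [hflip fun v => increment f (.inl v) (condSet (i + 1) v),
    hflip fun v => increment f (.inl v) (condSet i v)] at h
  simp only [Finset.sum_const, Finset.card_univ, Fintype.card_pi, Fintype.card_bool,
    Finset.prod_const, Fintype.card_fin, nsmul_eq_mul, mul_one, Nat.cast_pow,
    Nat.cast_ofNat] at h
  linarith

/-- Adding the leaf of `v` only lowers the increment and keeps the set independent: for even `v` the
leaf is already there, and for odd `v` its neighbour `v` is not. Then `v` completes its pendant
edge. -/
theorem one_le_increment_condSet {f : Set ((Fin d → Bool) ⊕ (Fin d → Bool)) → ℝ}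
    (hf : IsSecretPolymatroid (accessStructure (cubeStar d)) f) (v : Fin d → Bool) :
    1 ≤ increment f (.inl v) (condSet d v) := by
  refine le_trans ?_ (hf.increment_anti (.inl v) (Set.subset_insert (.inr v) _))
  refine hf.one_le_increment ?_ ⟨.inl v, by simp, .inr v, by simp, rfl⟩
  rintro ⟨w, hw, z, hz, h⟩
  have key : ∀ u u', Sum.inl u ∈ insert (Sum.inr v) (condSet d v) →
      Sum.inr u' ∈ insert (Sum.inr v) (condSet d v) → u ≠ u' := by
    rintro u u' (hu | hu) hu' rfl
    · cases hu
    · rcases hu' with hu' | hu'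
      · exact hu.2.1 (Sum.inr_injective hu')
      · exact absurd (hu.1.symm.trans hu'.1) (by decide)
  rcases w with u | u <;> rcases z with u' | u'
  · rcases hw with hw | hw
    · cases hw
    · rcases hz with hz | hz
      · cases hz
      · exact parity_ne_of_adj h (hw.1.trans hz.1.symm)
  · exact key u u' hw hz h
  · exact key u' u hz hw (Eq.symm h)
  · exact h

theorem le_sum_singleton {f : Set ((Fin d → Bool) ⊕ (Fin d → Bool)) → ℝ}
    (hf : IsSecretPolymatroid (accessStructure (cubeStar d)) f) :
    2 ^ d * (((d : ℝ) + 2) / 2) ≤ ∑ v : Fin d → Bool, f {.inl v} := by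
  have h0 : ∑ v, increment f (.inl v) (condSet 0 v) ≤ ∑ v : Fin d → Bool, f {.inl v} := by
    refine Finset.sum_le_sum fun v _ => ?_
    refine (hf.increment_anti (.inl v) (Set.empty_subset _)).trans ?_
    rw [increment, insert_empty_eq]
    linarith [hf.nonneg ∅]
  have hk : ∀ k ≤ d, ∑ v, increment f (.inl v) (condSet k v) + k * (2 ^ d / 2) ≤
      ∑ v, increment f (.inl v) (condSet (d := d) 0 v) := by
    intro k
    induction k with
    | zero => intro _; simp
    | succ k ih =>
      intro hk
      have h1 := ih (by omega)
      have h2 := sum_increment_condSet_step hf ⟨k, hk⟩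
      simp only at h2
      push_cast
      linarith
  have hd : (2 : ℝ) ^ d ≤ ∑ v, increment f (.inl v) (condSet d v) := by
    have := Finset.sum_le_sum fun (v : Fin d → Bool) (_ : v ∈ Finset.univ) =>
      one_le_increment_condSet hf v
    simpa using this
  linarith [hk d le_rfl]

theorem exists_le_singleton {f : Set ((Fin d → Bool) ⊕ (Fin d → Bool)) → ℝ}
    (hf : IsSecretPolymatroid (accessStructure (cubeStar d)) f) :
    ∃ v, ((d : ℝ) + 2) / 2 ≤ f {v} := by
  by_contra! h
  have := Finset.sum_lt_sum_of_nonempty (s := (Finset.univ : Finset (Fin d → Bool)))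
    Finset.univ_nonempty fun v _ => h (.inl v)
  simp only [Finset.sum_const, Finset.card_univ, Fintype.card_pi, Fintype.card_bool,
    Finset.prod_const, Fintype.card_fin, nsmul_eq_mul, Nat.cast_pow, Nat.cast_ofNat] at this
  linarith [le_sum_singleton hf]

theorem le_worstCaseRatio_cubeStar (d : ℕ) :
    ENNReal.ofReal (((d : ℝ) + 2) / 2) ≤ worstCaseRatio (cubeStar d) :=
  le_iInf fun S => S.le_iSup_ratio (isUpperSet_accessStructure _) fun _ => exists_le_singleton

end LowerBound

/-! ### The upper bound -/

/-! ### Entropy and independence from uniform laws -/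

section Uniform

variable {Ω α β : Type}

theorem map_apply_comp_equiv (p : PMF Ω) (e : Ω ≃ Ω) (he : ∀ ω, p (e ω) = p ω) (X : Ω → α)
    (x : α) : p.map (fun ω => X (e ω)) x = p.map X x := by
  classical
  rw [PMF.map_apply, PMF.map_apply, ← Equiv.tsum_eq e fun ω => if x = X ω then p ω else 0]
  simp_rw [he]

theorem tsum_map_pair_apply (p : PMF Ω) (X : Ω → α) (Y : Ω → β) (x : α) :
    ∑' y, p.map (fun ω => (X ω, Y ω)) (x, y) = p.map X x := by
  classical
  simp_rw [PMF.map_apply]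
  rw [ENNReal.tsum_comm]
  refine tsum_congr fun ω => ?_
  rw [tsum_eq_single (Y ω)]
  · simp
  · intro y hy
    simp [hy]

theorem apply_eq_inv_card [Fintype β] (q : PMF β) (h : ∀ y y', q y = q y') (y : β) :
    q y = (Fintype.card β : ℝ≥0∞)⁻¹ := by
  have h1 := q.tsum_coe
  rw [tsum_fintype, Finset.sum_congr rfl fun y' _ => h y' y, Finset.sum_const, Finset.card_univ,
    nsmul_eq_mul, mul_comm] at h1
  exact ENNReal.eq_inv_of_mul_eq_one_left h1

theorem entropy_of_uniform [Fintype β] (p : PMF Ω) (Y : Ω → β)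
    (h : ∀ y y', p.map Y y = p.map Y y') :
    entropy p Y = ENNReal.ofReal (Real.log (Fintype.card β)) := by
  simp_rw [entropy_eq_tsum, apply_eq_inv_card _ h, ENNReal.tsum_mul_right, PMF.tsum_coe, one_mul,
    info, ENNReal.toReal_inv, Real.log_inv, neg_neg, ENNReal.toReal_natCast]

/-- Given any value of `X`, the conditional law of `Y` is uniform, like its own law. This reduces
perfectness to a symmetry translating the secret. -/
theorem indep_of_uniform [Fintype β] (p : PMF Ω) (X : Ω → α) (Y : Ω → β)
    (hY : ∀ y y', p.map Y y = p.map Y y')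
    (h : ∀ x y y', p.map (fun ω => (X ω, Y ω)) (x, y) = p.map (fun ω => (X ω, Y ω)) (x, y')) :
    Indep p X Y := by
  intro x y
  have : Nonempty β := ⟨y⟩
  rw [apply_eq_inv_card _ hY, ← tsum_map_pair_apply p X Y x, tsum_fintype,
    Finset.sum_congr rfl fun y' _ => h x y' y, Finset.sum_const, Finset.card_univ, nsmul_eq_mul,
    mul_comm, ← mul_assoc, ENNReal.inv_mul_cancel (by simp) (by simp), one_mul]

end Uniform

/-! ### The star scheme of a bipartite graph -/

section StarScheme

variable {V : Type} (G : SimpleGraph V) (c : V → Bool)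

/-- The randomness of the star scheme: a secret with one bit for each of the two colours, and one
random bit for each vertex. -/
abbrev StarSpace (V : Type) : Type := (Bool → ZMod 2) × (V → ZMod 2)

open Classical in
/-- The star centred at `w` distributes the bit of the secret belonging to the colour of `w`: the
centre gets the random bit of `w`, and every neighbour gets its sum with the bit of the secret. -/
noncomputable def starShare (v : V) (ω : StarSpace V) (w : {w // w = v ∨ G.Adj v w}) : ZMod 2 :=
  if w.1 = v then ω.2 v else ω.2 w.1 + ω.1 (c w.1)

/-- The translation of the secret by `t` which preserves the shares of the independent set `A`. -/
noncomputable def starShift (A : Set V) (t : Bool → ZMod 2) : StarSpace V ≃ StarSpace V :=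
  Equiv.addRight (t, Aᶜ.indicator fun v => -t (c v))

variable {G c}

/-- A member of `A` meets a changed random bit only as the neighbour of a centre outside `A`, and
there the correction cancels the translation of the secret bit. -/
theorem starShare_starShift {A : Set V} (hA : A ∉ accessStructure G) (t : Bool → ZMod 2) {v : V}
    (hv : v ∈ A) (ω : StarSpace V) :
    starShare G c v (starShift c A t ω) = starShare G c v ω := by
  funext ⟨w, hw⟩
  unfold starShare
  by_cases h : w = v
  · simp [h, hv, starShift]
  · have hwA : w ∉ A := fun hwA => hA ⟨v, hv, w, hwA, hw.resolve_left h⟩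
    simp only [h, if_false, starShift, Equiv.coe_addRight, Prod.fst_add, Prod.snd_add,
      Pi.add_apply]
    rw [Set.indicator_of_mem (by exact hwA)]
    ring

/-- On an edge `uv`, the share of `v` holds the random bit of `v` and the share of `u` holds its sum
with the secret bit of colour `c v`. The symmetric argument gives the bit of colour `c u`, and the
two colours are distinct. -/
theorem starShare_eq_imp (hc : ∀ u v, G.Adj u v → c u ≠ c v) {A : Set V}
    (hA : A ∈ accessStructure G) {ω ω' : StarSpace V}
    (h : ∀ v ∈ A, starShare G c v ω = starShare G c v ω') : ω.1 = ω'.1 := by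
  have key : ∀ u ∈ A, ∀ v ∈ A, G.Adj u v → ω.1 (c v) = ω'.1 (c v) := by
    intro u hu v hv huv
    have h1 := congrFun (h v hv) ⟨v, Or.inl rfl⟩
    have h2 := congrFun (h u hu) ⟨v, Or.inr huv⟩
    simp only [starShare, if_true] at h1
    simpa [starShare, huv.ne', h1] using h2
  obtain ⟨u, hu, v, hv, huv⟩ := hA
  funext b
  rcases Bool.eq_or_eq_not b (c u) with rfl | hb
  · exact key v hv u hu huv.symm
  · rw [hb, ← Bool.eq_not_of_ne (hc u v huv).symm]
    exact key u hu v hv huv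

variable (G c) [Fintype V] [DecidableEq V]

theorem map_secret_starSpace (t t' : Bool → ZMod 2) :
    (PMF.uniformOfFintype (StarSpace V)).map Prod.fst t =
      (PMF.uniformOfFintype (StarSpace V)).map Prod.fst t' := by
  rw [← map_apply_comp_equiv _ (Equiv.addRight (t - t', 0)) (by simp) Prod.fst t,
    PMF.map_apply, PMF.map_apply]
  refine tsum_congr fun ω => ?_
  simp [← sub_eq_iff_eq_add]

theorem entropy_secret_starSpace :
    entropy (PMF.uniformOfFintype (StarSpace V)) Prod.fst = ENNReal.ofReal (2 * Real.log 2) := by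
  rw [entropy_of_uniform _ _ map_secret_starSpace, Fintype.card_fun, ZMod.card, Fintype.card_bool,
    Nat.cast_pow, Real.log_pow, Nat.cast_ofNat]

/-- The scheme in which every vertex is the centre of a star. -/
noncomputable def starScheme (hc : ∀ u v, G.Adj u v → c u ≠ c v) :
    PerfectScheme (accessStructure G) where
  Ω := StarSpace V
  p := PMF.uniformOfFintype (StarSpace V)
  Share v := {w // w = v ∨ G.Adj v w} → ZMod 2
  Secret := Bool → ZMod 2
  share := starShare G c
  secret := Prod.fst
  entropy_secret_ne_zero := by
    have := Real.log_pos one_lt_two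
    rw [entropy_secret_starSpace, Ne, ENNReal.ofReal_eq_zero, not_le]
    positivity
  entropy_secret_ne_top := by
    rw [entropy_secret_starSpace]
    exact ENNReal.ofReal_ne_top
  correct A hA := by
    have hf : Function.FactorsThrough (Prod.fst : StarSpace V → _)
        (fun ω (i : A) => starShare G c i ω) := fun ω ω' h =>
      starShare_eq_imp hc hA fun v hv => congrFun h ⟨v, hv⟩
    obtain ⟨g, hg⟩ := (Function.factorsThrough_iff _).1 hf
    exact ⟨g, fun ω _ => congrFun hg ω⟩
  perfect A hA := by
    refine indep_of_uniform _ _ _ map_secret_starSpace fun x t t' => ?_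
    rw [← map_apply_comp_equiv _ (starShift c A (t - t')) (by simp)
      (fun ω => ((fun i : A => starShare G c i ω), ω.1)) (x, t), PMF.map_apply, PMF.map_apply]
    refine tsum_congr fun ω => ?_
    have h : (fun i : A => starShare G c i (starShift c A (t - t') ω)) =
        fun i : A => starShare G c i ω :=
      funext fun i => starShare_starShift hA _ i.2 ω
    rw [h]
    congr 1
    rw [Prod.mk_inj, Prod.mk_inj, eq_iff_iff]
    refine and_congr_right fun _ => ?_
    change t = ω.1 + (t - t') ↔ _
    rw [← sub_eq_iff_eq_add, sub_sub_cancel]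

variable [DecidableRel G.Adj]

theorem starScheme_ratio_le (hc : ∀ u v, G.Adj u v → c u ≠ c v) (v : V) :
    (starScheme G c hc).ratio v ≤ ENNReal.ofReal (((G.degree v : ℝ) + 1) / 2) := by
  have hcard : Fintype.card {w // w = v ∨ G.Adj v w} = G.degree v + 1 := by
    rw [Fintype.card_subtype, ← G.card_neighborFinset_eq_degree,
      ← Finset.card_insert_of_notMem (G.notMem_neighborFinset_self v)]
    congr 1
    ext w
    simp
  have h2 := Real.log_pos one_lt_two
  have hle := entropy_le_log_card (PMF.uniformOfFintype (StarSpace V)) (starShare G c v)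
  rw [Fintype.card_fun, hcard, ZMod.card, Nat.cast_pow, Real.log_pow] at hle
  change entropy (PMF.uniformOfFintype (StarSpace V)) (starShare G c v) /
    entropy (PMF.uniformOfFintype (StarSpace V)) Prod.fst ≤ _
  rw [entropy_secret_starSpace]
  refine (ENNReal.div_le_div_right hle _).trans ?_
  rw [← ENNReal.ofReal_div_of_pos (by positivity)]
  refine ENNReal.ofReal_le_ofReal (le_of_eq ?_)
  push_cast
  field_simp

/-- The bound `(Δ + 1) / 2` for bipartite graphs of maximum degree `Δ`. -/
theorem worstCaseRatio_le (hc : ∀ u v, G.Adj u v → c u ≠ c v) :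
    worstCaseRatio G ≤ ENNReal.ofReal (((G.maxDegree : ℝ) + 1) / 2) := by
  refine iInf_le_of_le (starScheme G c hc) (iSup_le fun v => ?_)
  refine (starScheme_ratio_le G c hc v).trans (ENNReal.ofReal_le_ofReal ?_)
  have : (G.degree v : ℝ) ≤ G.maxDegree := by exact_mod_cast G.degree_le_maxDegree v
  linarith

end StarScheme

/-! ### Two-colouring and degrees of the cube with leaves -/

section CubeStar

variable {d : ℕ}

theorem cubeStar_coloring (u v : (Fin d → Bool) ⊕ (Fin d → Bool)) (h : (cubeStar d).Adj u v) :
    Sum.elim parity (fun x => !parity x) u ≠ Sum.elim parity (fun x => !parity x) v := by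
  rcases u with u | u <;> rcases v with v | v
  · exact parity_ne_of_adj h
  · obtain rfl : u = v := h
    simp
  · obtain rfl : u = v := h
    simp
  · exact h.elim

variable [DecidableRel (cubeStar d).Adj]

theorem degree_cubeStar_inl (v : Fin d → Bool) : (cubeStar d).degree (.inl v) = d + 1 := by
  have : (cubeStar d).neighborFinset (.inl v) =
      insert (.inr v) (Finset.univ.image fun i => Sum.inl (flipAt i v)) := by
    ext (w | w)
    · simp only [SimpleGraph.mem_neighborFinset, Finset.mem_insert, reduceCtorEq, false_or,
        Finset.mem_image, Finset.mem_univ, true_and, Sum.inl.injEq]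
      exact cube_adj_iff.trans (exists_congr fun i => eq_comm)
    · simp only [SimpleGraph.mem_neighborFinset, Finset.mem_insert, Finset.mem_image,
        reduceCtorEq, and_false, exists_false, or_false, Sum.inr.injEq]
      exact eq_comm
  rw [← SimpleGraph.card_neighborFinset_eq_degree, this, Finset.card_insert_of_notMem (by simp),
    Finset.card_image_of_injective (f := fun i => Sum.inl (flipAt i v)) _ (Sum.inl_injective.comp (flipAt_injective_left v)),
    Finset.card_univ, Fintype.card_fin]

theorem degree_cubeStar_inr (v : Fin d → Bool) : (cubeStar d).degree (.inr v) = 1 := by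
  have : (cubeStar d).neighborFinset (.inr v) = {.inl v} := by
    ext (w | w)
    · simp only [SimpleGraph.mem_neighborFinset, Finset.mem_singleton, Sum.inl.injEq]
      exact eq_comm
    · simp only [SimpleGraph.mem_neighborFinset, Finset.mem_singleton, reduceCtorEq, iff_false]
      exact id
  rw [← SimpleGraph.card_neighborFinset_eq_degree, this, Finset.card_singleton]

theorem maxDegree_cubeStar : (cubeStar d).maxDegree = d + 1 := by
  refine le_antisymm (SimpleGraph.maxDegree_le_of_forall_degree_le _ _ ?_) ?_
  · rintro (v | v)
    · rw [degree_cubeStar_inl]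
    · rw [degree_cubeStar_inr]
      omega
  · rw [← degree_cubeStar_inl fun _ => false]
    exact SimpleGraph.degree_le_maxDegree _ _

end CubeStar

theorem worstCaseRatio_cubeStar (d : ℕ) : worstCaseRatio (cubeStar d) = ((d : ℝ≥0∞) + 2) / 2 := by
  classical
  have h : ENNReal.ofReal (((d : ℝ) + 2) / 2) = ((d : ℝ≥0∞) + 2) / 2 := by
    rw [ENNReal.ofReal_div_of_pos two_pos, ENNReal.ofReal_add (by positivity) two_pos.le,
      ENNReal.ofReal_natCast, ENNReal.ofReal_ofNat]
  refine le_antisymm ?_ (h ▸ le_worstCaseRatio_cubeStar d)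
  refine (worstCaseRatio_le (cubeStar d) _ cubeStar_coloring).trans (le_of_eq ?_)
  rw [← h, maxDegree_cubeStar]
  push_cast
  ring_nf

end SecretSharing

theorem theorem3p4 (δ : ℕ) (hδ : 1 ≤ δ) [DecidableRel (SecretSharing.cubeStar (δ - 1)).Adj] :
    Fintype.card ((Fin (δ - 1) → Bool) ⊕ (Fin (δ - 1) → Bool)) = 2 ^ δ ∧
      (SecretSharing.cubeStar (δ - 1)).maxDegree = δ ∧
      SecretSharing.worstCaseRatio (SecretSharing.cubeStar (δ - 1)) = ((δ : ℝ≥0∞) + 1) / 2 := by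
  obtain ⟨d, rfl⟩ := Nat.exists_eq_add_of_le' hδ
  refine ⟨?_, SecretSharing.maxDegree_cubeStar, ?_⟩
  · simp [pow_succ, mul_two]
  · have h := SecretSharing.worstCaseRatio_cubeStar d
    rw [Nat.add_sub_cancel, h]
    push_cast
    rw [add_assoc, one_add_one_eq_two]
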